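/- Let $E$ be a locally compact Hausdorff space with a countable base, equipped with its Borel $\sigma$-algebra, and let $obs : E \to [0,1]$ be continuous. Let $\Omega$ be the space of continuous maps $\omega : [0,\infty) \to E$ with the topology of locally uniform convergence (compact-open topology) and the $\sigma$-algebra generated by the evaluations $X_t(\omega) = \omega(t)$. Let $(\hat P_t)_{t \ge 0}$ be an honest Feller–Dynkin semigroup on $C_0(E)$, i.e. a strongly continuous semigroup of bounded linear operators on $C_0(E)$ such that $0 \le f \le 1$ implies $0 \le \hat P_t f \le 1$, and whose kernels $P_t$, determined by $\hat P_t f(x) = \int f \, dP_t(x)$ for $f \in C_0(E)$, are Markov kernels. Assume that the associated process is a diffusion: for every $x \in E$ there is a probability measure $\mathbb{P}^x$ on $\Omega$ under which $$\mathbb{P}^x(X_0 \in dx_0, X_{t_1} \in dx_1, \dots, X_{t_n} \in dx_n) = \delta_x(dx_0)\, P_{t_1}(x_0, dx_1) \cdots P_{t_n - t_{n-1}}(x_{n-1}, dx_n)$$ for all $0 < t_1 < \dots < t_n$, and $x \mapsto \mathbb{P}^x$ is weakly continuous. Fix $0 < c < 1$. For a lower semicontinuous pseudometric $m : E \times E \to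 [0,1]$ put $$U_c(m)(\omega, \omega') = \sup_{t \ge 0} c^t\, m(\omega(t), \omega'(t)), \qquad \mathcal{G}_c(m)(x,y) = \inf_{\gamma} \int U_c(m) \, d\gamma,$$ where $\gamma$ ranges over the couplings of $\mathbb{P}^x$ and $\mathbb{P}^y$. Let $d_0^c(x,y) = |obs(x) - obs(y)|$, $d_{n+1}^c = \mathcal{G}_c(d_n^c)$ for $n \ge 0$, and $\overline{d}^c = \sup_{n \ge 0} d_n^c$. Then $\overline{d}^c$ is a lower semicontinuous 1-bounded pseudometric on $E$ with $\mathcal{G}_c(\overline{d}^c) = \overline{d}^c$ and $\overline{d}^c(x,y) \ge |obs(x) - obs(y)|$ for all $x, y \in E$, and every lower semicontinuous 1-bounded pseudometric $m$ on $E$ with $\mathcal{G}_c(m) = m$ and $m(x,y) \ge |obs(x) - obs(y)|$ for all $x,y \in E$ satisfies $m \ge \overline{d}^c$ pointwise. That is, $\overline{d}^c$ is the least fixpoint of $\mathcal{G}_c$ among lower semicontinuous 1-bounded pseudometrics that dominate $(x,y) \mapsto |obs(x) - obs(y)|$. -/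

import Mathlib

open MeasureTheory ProbabilityTheory Filter Topology
open scoped NNReal ENNReal ZeroAtInfty BoundedContinuousFunction

noncomputable section

namespace TrajectoryMetric

/-! ### Feller-Dynkin semigroups and diffusions -/

/-- A Feller-Dynkin semigroup: a strongly continuous semigroup of bounded linear operators on
`C₀(E)` such that `0 ≤ f ≤ 1` implies `0 ≤ P̂ₜ f ≤ 1`. -/
structure FDSemigroup (E : Type*) [TopologicalSpace E] where
  /-- the operators `P̂ₜ` -/
  op : ℝ≥0 → (C₀(E, ℝ) →L[ℝ] C₀(E, ℝ))
  op_zero : op 0 = ContinuousLinearMap.id ℝ C₀(E, ℝ)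
  op_comp : ∀ s t : ℝ≥0, (op s).comp (op t) = op (s + t)
  strongly_continuous : ∀ f : C₀(E, ℝ), Tendsto (fun t : ℝ≥0 => ‖op t f - f‖) (𝓝[>] 0) (𝓝 0)
  op_mem_Icc : ∀ (t : ℝ≥0) (f : C₀(E, ℝ)), (∀ x, 0 ≤ f x ∧ f x ≤ 1) →
    ∀ x, 0 ≤ op t f x ∧ op t f x ≤ 1

/-- An honest Feller-Dynkin semigroup: the kernels `Pₜ` with `P̂ₜ f (x) = ∫ f dPₜ(x)` for all
`f ∈ C₀(E)`, which are uniquely determined by the semigroup, have total mass `1`. -/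
structure HonestFDSemigroup (E : Type*) [TopologicalSpace E] [MeasurableSpace E]
    extends FDSemigroup E where
  /-- the transition kernels `Pₜ` -/
  kernel : ℝ≥0 → Kernel E E
  op_eq_integral : ∀ (t : ℝ≥0) (f : C₀(E, ℝ)) (x : E), op t f x = ∫ y, f y ∂(kernel t x)
  honest : ∀ t : ℝ≥0, IsMarkovKernel (kernel t)

/-- The trajectory space `Ω`: continuous maps `[0, ∞) → E`, with Mathlib's compact-open topology
(uniform convergence on bounded time intervals). -/
abbrev Trajectory (E : Type*) [TopologicalSpace E] : Type _ := C(ℝ≥0, E)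

/-- The σ-algebra `σ(X_s | s ≥ 0)` on `Ω` generated by the evaluations `X_s(ω) = ω(s)`. -/
instance instMeasurableSpaceTrajectory (E : Type*) [TopologicalSpace E] [MeasurableSpace E] :
    MeasurableSpace (Trajectory E) :=
  ⨆ s : ℝ≥0, MeasurableSpace.comap (fun ω : Trajectory E => ω s) inferInstance

/-- For `s < t₁ < ⋯ < tₙ`, the value of `cylinderProb P s x [(t₁, C₁), …, (tₙ, Cₙ)]` is
`∫_{C₁} P_{t₁ - s}(x, dx₁) ∫_{C₂} P_{t₂ - t₁}(x₁, dx₂) ⋯ ∫_{Cₙ} P_{tₙ - tₙ₋₁}(xₙ₋₁, dxₙ)`. -/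
def cylinderProb {E : Type*} [MeasurableSpace E] (P : ℝ≥0 → Kernel E E) :
    ℝ≥0 → E → List (ℝ≥0 × Set E) → ℝ≥0∞
  | _, _, [] => 1
  | s, x, (t, C) :: l => ∫⁻ y in C, cylinderProb P t y l ∂(P (t - s) x)

/-- `Q` is the law `ℙ^μ` on `Ω` with initial distribution `μ` and transition kernels `P`: for
`0 < t₁ < ⋯ < tₙ` and measurable `C₀, C₁, …, Cₙ`, the probability
`Q(X₀ ∈ C₀, X_{t₁} ∈ C₁, …, X_{tₙ} ∈ Cₙ)` equals
`∫_{C₀} μ(dx₀) ∫_{C₁} P_{t₁}(x₀, dx₁) ⋯ ∫_{Cₙ} P_{tₙ - tₙ₋₁}(xₙ₋₁, dxₙ)`. -/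
def IsLawFrom {E : Type*} [TopologicalSpace E] [MeasurableSpace E] (P : ℝ≥0 → Kernel E E)
    (μ : Measure E) (Q : Measure (Trajectory E)) : Prop :=
  ∀ (C₀ : Set E) (l : List (ℝ≥0 × Set E)), MeasurableSet C₀ → (∀ p ∈ l, MeasurableSet p.2) →
    List.IsChain (· < ·) (0 :: l.map Prod.fst) →
      Q {ω | ω 0 ∈ C₀ ∧ ∀ p ∈ l, ω p.1 ∈ p.2} = ∫⁻ x in C₀, cylinderProb P 0 x l ∂μ

/-- A diffusion: an honest Feller-Dynkin process whose trajectories are continuous, so that its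
laws `ℙ^x` live on `Ω = C([0, ∞), E)`, and for which `x ↦ ℙ^x` is weakly continuous. -/
structure Diffusion (E : Type*) [TopologicalSpace E] [MeasurableSpace E]
    extends HonestFDSemigroup E where
  /-- the law `ℙ^x` of the process started at `x` -/
  law : E → ProbabilityMeasure (Trajectory E)
  isLawFrom : ∀ x : E, IsLawFrom kernel (Measure.dirac x) (law x : Measure (Trajectory E))
  weakly_continuous : ∀ (u : ℕ → E) (x : E), Tendsto u atTop (𝓝 x) →
    ∀ f : Trajectory E →ᵇ ℝ,
      Tendsto (fun n => ∫ ω, f ω ∂(law (u n) : Measure (Trajectory E))) atTop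
        (𝓝 (∫ ω, f ω ∂(law x : Measure (Trajectory E))))

/-! ### Lattices of pseudometrics -/

/-- The lattice `𝓜` of 1-bounded pseudometrics on a set, as real functions of two arguments
ordered pointwise. -/
structure IsBoundedPseudometric {X : Type*} (m : X → X → ℝ) : Prop where
  nonneg : ∀ x y, 0 ≤ m x y
  le_one : ∀ x y, m x y ≤ 1
  self : ∀ x, m x x = 0
  symm : ∀ x y, m x y = m y x
  triangle : ∀ x y z, m x z ≤ m x y + m y z

/-- The lattice `𝓟` of lower semicontinuous 1-bounded pseudometrics. -/
structure IsLscPseudometric {X : Type*} [TopologicalSpace X] (m : X → X → ℝ) : Prop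
    extends IsBoundedPseudometric m where
  lsc : LowerSemicontinuous fun p : X × X => m p.1 p.2

/-! ### Optimal transport -/

/-- The set `Γ(μ, ν)` of couplings of two probability measures. -/
def couplings {X Y : Type*} [MeasurableSpace X] [MeasurableSpace Y] (μ : ProbabilityMeasure X)
    (ν : ProbabilityMeasure Y) : Set (ProbabilityMeasure (X × Y)) :=
  {γ | (γ : Measure (X × Y)).map Prod.fst = (μ : Measure X) ∧
    (γ : Measure (X × Y)).map Prod.snd = (ν : Measure Y)}

/-- The optimal transport cost `W(k)(μ, ν)` for the cost function `k`. -/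
def transportCost {X : Type*} [MeasurableSpace X] (k : X → X → ℝ) (μ ν : ProbabilityMeasure X) :
    ℝ :=
  sInf ((fun γ : ProbabilityMeasure (X × X) => ∫ p, k p.1 p.2 ∂(γ : Measure (X × X))) ''
    couplings μ ν)

/-! ### The functional and its iterates -/

/-- The discounted uniform pseudometric `U_c(m)(ω, ω') = sup_t c^t m(ω(t), ω'(t))`. -/
def discountedUniform {E : Type*} [TopologicalSpace E] (c : ℝ) (m : E → E → ℝ)
    (ω ω' : Trajectory E) : ℝ :=
  ⨆ t : ℝ≥0, c ^ (t : ℝ) * m (ω t) (ω' t)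

/-- The functional `𝓖_c(m)(x, y) = W(U_c(m))(ℙ^x, ℙ^y)`. -/
def Diffusion.functional {E : Type*} [TopologicalSpace E] [MeasurableSpace E] (D : Diffusion E)
    (c : ℝ) (m : E → E → ℝ) : E → E → ℝ :=
  fun x y => transportCost (discountedUniform c m) (D.law x) (D.law y)

/-- The pseudometric `(x, y) ↦ |obs(x) - obs(y)|`. -/
def obsDist {E : Type*} [TopologicalSpace E] (obs : C(E, unitInterval)) : E → E → ℝ :=
  fun x y => |(obs x : ℝ) - (obs y : ℝ)|

/-- The sequence `d₀ = |obs(·) - obs(·)|`, `dₙ₊₁ = 𝓖_c(dₙ)`. -/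
def Diffusion.iterate {E : Type*} [TopologicalSpace E] [MeasurableSpace E] (D : Diffusion E)
    (obs : C(E, unitInterval)) (c : ℝ) : ℕ → E → E → ℝ
  | 0 => obsDist obs
  | n + 1 => D.functional c (D.iterate obs c n)

/-- The pseudometric `d̄^c = sup_n dₙ`. -/
def Diffusion.dbar {E : Type*} [TopologicalSpace E] [MeasurableSpace E] (D : Diffusion E)
    (obs : C(E, unitInterval)) (c : ℝ) : E → E → ℝ :=
  fun x y => ⨆ n : ℕ, D.iterate obs c n x y

end TrajectoryMetric

end

/-!
The functional `𝓖_c` is inflationary because almost every trajectory under `ℙ^x` starts at `x`, so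
its least fixpoint above `d₀` is reached by Kleene iteration as soon as `𝓖_c` preserves lower
semicontinuous pseudometrics and commutes with suprema of increasing sequences of them. Both rest on
Prokhorov's theorem, in the form that the marginal map `𝓟(Ω × Ω) → 𝓟(Ω) × 𝓟(Ω)` is proper. Sublevel
sets of the transport cost are images under this map of sublevel sets of `γ ↦ ∫ k dγ`, so they are
closed because a proper map is closed; and the compactness of its fibres, the sets of couplings,
allows the infimum over couplings to be exchanged with an increasing supremum of cost functions.
-/

namespace TrajectoryMetric

section PolishSpace

theorem isOpenEmbedding_of_isDenseEmbedding {X Y : Type*} [TopologicalSpace X]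
    [TopologicalSpace Y] [LocallyCompactSpace X] [T2Space Y] {i : X → Y}
    (hi : IsDenseEmbedding i) : IsOpenEmbedding i := by
  refine ⟨hi.isEmbedding, isOpen_iff_mem_nhds.2 ?_⟩
  rintro _ ⟨x, rfl⟩
  obtain ⟨K, hK, hxK⟩ := exists_compact_mem_nhds x
  rw [hi.isInducing.nhds_eq_comap] at hxK
  obtain ⟨V, hV, hVK⟩ := hxK
  obtain ⟨W, hWV, hW, hxW⟩ := mem_nhds_iff.1 hV
  refine mem_of_superset (hW.mem_nhds hxW) ?_
  calc W ⊆ closure (W ∩ Set.range i) := hi.dense.open_subset_closure_inter hW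
    _ ⊆ i '' K := closure_minimal
        (by rintro _ ⟨hyW, y, rfl⟩; exact ⟨y, hVK (hWV hyW), rfl⟩)
        (hK.image hi.continuous).isClosed
    _ ⊆ Set.range i := Set.image_subset_range i K

theorem polishSpace_of_locallyCompactSpace (X : Type*) [TopologicalSpace X]
    [LocallyCompactSpace X] [T2Space X] [SecondCountableTopology X] : PolishSpace X := by
  let := TopologicalSpace.metrizableSpaceMetric X
  have hi : IsOpenEmbedding ((↑) : X → UniformSpace.Completion X) :=
    isOpenEmbedding_of_isDenseEmbedding UniformSpace.Completion.isDenseEmbedding_coe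
  have := hi.isOpen_range.polishSpace
  exact hi.isEmbedding.toHomeomorph.isClosedEmbedding.polishSpace

end PolishSpace

section Trajectory

variable {E : Type*} [TopologicalSpace E] [MeasurableSpace E]

theorem measurable_eval (t : ℝ≥0) : Measurable fun ω : Trajectory E => ω t :=
  Measurable.of_comap_le <|
    le_iSup (fun s : ℝ≥0 => MeasurableSpace.comap (fun ω : Trajectory E => ω s) inferInstance) t

instance [PolishSpace E] : PolishSpace (Trajectory E) := by
  let := TopologicalSpace.upgradeIsCompletelyMetrizable E
  infer_instance

theorem borel_le_measurableSpace [PolishSpace E] [BorelSpace E] :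
    borel (Trajectory E) ≤ instMeasurableSpaceTrajectory E := by
  obtain ⟨T, hT, hdense⟩ := TopologicalSpace.exists_countable_dense ℝ≥0
  have : Countable T := hT.to_subtype
  let ev : Trajectory E → T → E := fun ω t => ω t
  have hev_cont : Continuous ev := by fun_prop
  have hev_inj : Function.Injective ev := fun ω ω' h =>
    ContinuousMap.ext <| congrFun <|
      ω.continuous.ext_on hdense ω'.continuous fun t ht => congrFun h ⟨t, ht⟩
  have hev_meas : Measurable ev := measurable_pi_lambda _ fun t => measurable_eval (t : ℝ≥0)
  -- Lusin–Souslin: a continuous injection between Polish spaces is a Borel embedding.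
  have hborel : MeasurableSpace.comap ev inferInstance = borel (Trajectory E) :=
    letI := borel (Trajectory E)
    haveI : BorelSpace (Trajectory E) := ⟨rfl⟩
    (hev_cont.measurableEmbedding hev_inj).comap_eq
  exact hborel ▸ hev_meas.comap_le

instance [PolishSpace E] [BorelSpace E] : BorelSpace (Trajectory E) where
  measurable_eq := borel_le_measurableSpace.antisymm' <| iSup_le fun t => by
    rw [← measurable_iff_comap_le, BorelSpace.measurable_eq (α := E)]
    exact (continuous_eval_const t : Continuous fun ω : Trajectory E => ω t).borel_measurable

end Trajectory

section LowerSemicontinuity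

variable {X : Type*} [TopologicalSpace X] [MeasurableSpace X] [OpensMeasurableSpace X] {f : X → ℝ}

theorem lintegral_ofReal_le_liminf [HasOuterApproxClosed X] (hf : LowerSemicontinuous f)
    (h0 : ∀ x, 0 ≤ f x) {μs : ℕ → ProbabilityMeasure X} {μ : ProbabilityMeasure X}
    (hμ : Tendsto μs atTop (𝓝 μ)) :
    ∫⁻ x, ENNReal.ofReal (f x) ∂(μ : Measure X) ≤
      liminf (fun n => ∫⁻ x, ENNReal.ofReal (f x) ∂(μs n : Measure X)) atTop := by
  have layer_cake : ∀ ν : ProbabilityMeasure X, ∫⁻ x, ENNReal.ofReal (f x) ∂(ν : Measure X) =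
      ∫⁻ t in Set.Ioi (0 : ℝ), (ν : Measure X) {x | t < f x} := fun ν =>
    lintegral_eq_lintegral_meas_lt _ (ae_of_all _ h0) hf.measurable.aemeasurable
  simp only [layer_cake]
  calc ∫⁻ t in Set.Ioi (0 : ℝ), (μ : Measure X) {x | t < f x}
      ≤ ∫⁻ t in Set.Ioi (0 : ℝ), liminf (fun n => (μs n : Measure X) {x | t < f x}) atTop :=
        lintegral_mono fun t =>
          ProbabilityMeasure.le_liminf_measure_open_of_tendsto hμ (hf.isOpen_preimage t)
    _ ≤ liminf (fun n => ∫⁻ t in Set.Ioi (0 : ℝ), (μs n : Measure X) {x | t < f x}) atTop :=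
        lintegral_liminf_le fun n => Antitone.measurable fun s t hst =>
          measure_mono fun x hx => lt_of_le_of_lt hst hx

theorem integrable_of_lowerSemicontinuous (hf : LowerSemicontinuous f) {a b : ℝ}
    (hmem : ∀ x, f x ∈ Set.Icc a b) (μ : Measure X) [IsFiniteMeasure μ] : Integrable f μ :=
  Integrable.of_mem_Icc a b hf.measurable.aemeasurable (ae_of_all μ hmem)

theorem lowerSemicontinuous_integral [TopologicalSpace.PseudoMetrizableSpace X]
    [TopologicalSpace.SeparableSpace X] (hf : LowerSemicontinuous f) {b : ℝ}
    (hmem : ∀ x, f x ∈ Set.Icc 0 b) :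
    LowerSemicontinuous fun μ : ProbabilityMeasure X => ∫ x, f x ∂(μ : Measure X) := by
  have h0 : ∀ x, 0 ≤ f x := fun x => (hmem x).1
  have hof : ∀ μ : ProbabilityMeasure X, ENNReal.ofReal (∫ x, f x ∂(μ : Measure X)) =
      ∫⁻ x, ENNReal.ofReal (f x) ∂(μ : Measure X) := fun μ =>
    ofReal_integral_eq_lintegral_ofReal (integrable_of_lowerSemicontinuous hf hmem μ)
      (ae_of_all _ h0)
  refine lowerSemicontinuous_iff_isClosed_preimage.2 fun r => IsSeqClosed.isClosed ?_
  intro μs μ hle hμ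
  have hr : 0 ≤ r := (integral_nonneg h0).trans (hle 0)
  refine (ENNReal.ofReal_le_ofReal_iff hr).1 ?_
  calc ENNReal.ofReal (∫ x, f x ∂(μ : Measure X))
      ≤ liminf (fun n => ENNReal.ofReal (∫ x, f x ∂(μs n : Measure X))) atTop := by
        simpa only [hof] using lintegral_ofReal_le_liminf hf h0 hμ
    _ ≤ ENNReal.ofReal r := liminf_le_of_frequently_le' <| Frequently.of_forall fun n =>
        ENNReal.ofReal_le_ofReal (hle n)

end LowerSemicontinuity

section Couplings

variable {X Y Z : Type*} [MeasurableSpace X] [MeasurableSpace Y] [MeasurableSpace Z]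
  {μ : ProbabilityMeasure X} {ν : ProbabilityMeasure Y}

theorem couplings_nonempty (μ : ProbabilityMeasure X) (ν : ProbabilityMeasure Y) :
    (couplings μ ν).Nonempty :=
  ⟨μ.prod ν, by simp [couplings, ProbabilityMeasure.toMeasure_prod]⟩

theorem map_swap_mem_couplings {γ : ProbabilityMeasure (X × Y)} (hγ : γ ∈ couplings μ ν) :
    γ.map measurable_swap.aemeasurable ∈ couplings ν μ :=
  ⟨(Measure.map_map measurable_fst measurable_swap).trans hγ.2,
    (Measure.map_map measurable_snd measurable_swap).trans hγ.1⟩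

theorem map_diag_mem_couplings (μ : ProbabilityMeasure X) :
    μ.map (measurable_id.prodMk measurable_id).aemeasurable ∈ couplings μ μ :=
  ⟨(Measure.map_map measurable_fst (measurable_id.prodMk measurable_id)).trans Measure.map_id,
    (Measure.map_map measurable_snd (measurable_id.prodMk measurable_id)).trans Measure.map_id⟩

theorem map_compProd_comap (μ : Measure X) [SFinite μ] (κ : Kernel Y Z) [IsSFiniteKernel κ]
    {f : X → Y} (hf : Measurable f) :
    (μ ⊗ₘ κ.comap f hf).map (Prod.map f id) = μ.map f ⊗ₘ κ := by
  refine Measure.ext_of_lintegral _ fun g hg => ?_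
  rw [lintegral_map hg (hf.prodMap measurable_id), Measure.lintegral_compProd (by fun_prop),
    Measure.lintegral_compProd hg, lintegral_map hg.lintegral_kernel_prod_right' hf]
  simp only [Kernel.comap_apply, Prod.map_apply, id_eq]

theorem exists_gluing [StandardBorelSpace Z] {ρ : ProbabilityMeasure Z}
    {γ₁ : ProbabilityMeasure (X × Y)} {γ₂ : ProbabilityMeasure (Y × Z)}
    (h₁ : γ₁ ∈ couplings μ ν) (h₂ : γ₂ ∈ couplings ν ρ) :
    ∃ τ : ProbabilityMeasure ((X × Y) × Z),
      (τ : Measure ((X × Y) × Z)).map Prod.fst = γ₁ ∧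
      (τ : Measure ((X × Y) × Z)).map (Prod.map Prod.snd id) = γ₂ := by
  have : Nonempty Z := (ρ : Measure Z).nonempty_of_neZero
  refine ⟨⟨(γ₁ : Measure (X × Y)) ⊗ₘ
    (γ₂ : Measure (Y × Z)).condKernel.comap Prod.snd measurable_snd, inferInstance⟩,
    Measure.fst_compProd _ _, ?_⟩
  rw [ProbabilityMeasure.coe_mk, map_compProd_comap, h₁.2, ← h₂.1]
  exact (γ₂ : Measure (Y × Z)).disintegrate _

theorem map_fst_mem_couplings_of_gluing {ρ : ProbabilityMeasure Z}
    {γ₁ : ProbabilityMeasure (X × Y)} {γ₂ : ProbabilityMeasure (Y × Z)}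
    (h₁ : γ₁ ∈ couplings μ ν) (h₂ : γ₂ ∈ couplings ν ρ) {τ : ProbabilityMeasure ((X × Y) × Z)}
    (hτ₁ : (τ : Measure ((X × Y) × Z)).map Prod.fst = γ₁)
    (hτ₂ : (τ : Measure ((X × Y) × Z)).map (Prod.map Prod.snd id) = γ₂) :
    τ.map (measurable_fst.prodMap measurable_id).aemeasurable ∈ couplings μ ρ := by
  constructor
  · rw [← h₁.1, ← hτ₁, ProbabilityMeasure.toMeasure_map,
      Measure.map_map measurable_fst (by fun_prop), Measure.map_map measurable_fst measurable_fst]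
    rfl
  · rw [← h₂.2, ← hτ₂, ProbabilityMeasure.toMeasure_map,
      Measure.map_map measurable_snd (by fun_prop), Measure.map_map measurable_snd (by fun_prop)]
    rfl

end Couplings

section Marginals

variable {X Y : Type*} [MeasurableSpace X] [MeasurableSpace Y]

/-- The pair of marginals of a probability measure on a product, as a map whose fibres are the
sets of couplings. -/
noncomputable def marginals (γ : ProbabilityMeasure (X × Y)) :
    ProbabilityMeasure X × ProbabilityMeasure Y :=
  (γ.map measurable_fst.aemeasurable, γ.map measurable_snd.aemeasurable)

theorem mem_couplings_iff_marginals_eq {γ : ProbabilityMeasure (X × Y)}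
    {μ : ProbabilityMeasure X} {ν : ProbabilityMeasure Y} :
    γ ∈ couplings μ ν ↔ marginals γ = (μ, ν) := by
  simp only [couplings, marginals, Set.mem_ofPred_eq, Prod.mk.injEq,
    ← ProbabilityMeasure.toMeasure_injective.eq_iff, ProbabilityMeasure.toMeasure_map]

variable [TopologicalSpace X] [BorelSpace X] [TopologicalSpace Y] [BorelSpace Y]

theorem continuous_marginals [SecondCountableTopologyEither X Y] :
    Continuous (marginals (X := X) (Y := Y)) :=
  (ProbabilityMeasure.continuous_map continuous_fst).prodMk
    (ProbabilityMeasure.continuous_map continuous_snd)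

variable [PolishSpace X] [PolishSpace Y]

theorem isTightMeasureSet_of_isCompact {K : Set (ProbabilityMeasure X)} (hK : IsCompact K) :
    IsTightMeasureSet {(μ : Measure X) | μ ∈ K} := by
  let := TopologicalSpace.upgradeIsCompletelyMetrizable X
  exact isTightMeasureSet_of_isCompact_closure hK.closure

theorem isCompact_preimage_marginals
    {K : Set (ProbabilityMeasure X × ProbabilityMeasure Y)} (hK : IsCompact K) :
    IsCompact (marginals ⁻¹' K) := by
  have htight : IsTightMeasureSet
      {((γ : ProbabilityMeasure (X × Y)) : Measure (X × Y)) | γ ∈ marginals ⁻¹' K} := by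
    refine IsTightMeasureSet.prodMk
      ((isTightMeasureSet_of_isCompact (hK.image continuous_fst)).subset ?_)
      ((isTightMeasureSet_of_isCompact (hK.image continuous_snd)).subset ?_)
    · rintro _ ⟨_, ⟨γ, hγ, rfl⟩, rfl⟩
      exact ⟨_, ⟨_, hγ, rfl⟩, rfl⟩
    · rintro _ ⟨_, ⟨γ, hγ, rfl⟩, rfl⟩
      exact ⟨_, ⟨_, hγ, rfl⟩, rfl⟩
  have hclosed : IsClosed (marginals ⁻¹' K) := hK.isClosed.preimage continuous_marginals
  exact hclosed.closure_eq ▸ isCompact_closure_of_isTightMeasureSet htight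

theorem isProperMap_marginals : IsProperMap (marginals (X := X) (Y := Y)) :=
  isProperMap_iff_isCompact_preimage.2
    ⟨continuous_marginals, fun _ => isCompact_preimage_marginals⟩

theorem isCompact_couplings (μ : ProbabilityMeasure X) (ν : ProbabilityMeasure Y) :
    IsCompact (couplings μ ν) := by
  have hfibre : couplings μ ν = marginals ⁻¹' {(μ, ν)} :=
    Set.ext fun _ => mem_couplings_iff_marginals_eq
  exact hfibre ▸ isCompact_preimage_marginals isCompact_singleton

end Marginals

section TransportCost

variable {X : Type*} [MeasurableSpace X] {k : X → X → ℝ} {μ ν ρ : ProbabilityMeasure X}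

theorem transportCost_le_integral (hk : ∀ x y, 0 ≤ k x y) {γ : ProbabilityMeasure (X × X)}
    (hγ : γ ∈ couplings μ ν) : transportCost k μ ν ≤ ∫ p, k p.1 p.2 ∂(γ : Measure (X × X)) := by
  refine csInf_le ⟨0, ?_⟩ ⟨γ, hγ, rfl⟩
  rintro _ ⟨γ', -, rfl⟩
  exact integral_nonneg fun p => hk p.1 p.2

theorem le_transportCost {r : ℝ}
    (h : ∀ γ ∈ couplings μ ν, r ≤ ∫ p, k p.1 p.2 ∂(γ : Measure (X × X))) :
    r ≤ transportCost k μ ν := by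
  refine le_csInf ((couplings_nonempty μ ν).image _) ?_
  rintro _ ⟨γ, hγ, rfl⟩
  exact h γ hγ

theorem transportCost_nonneg (hk : ∀ x y, 0 ≤ k x y) (μ ν : ProbabilityMeasure X) :
    0 ≤ transportCost k μ ν :=
  le_transportCost fun _ _ => integral_nonneg fun p => hk p.1 p.2

theorem transportCost_le_one (h0 : ∀ x y, 0 ≤ k x y) (h1 : ∀ x y, k x y ≤ 1)
    (μ ν : ProbabilityMeasure X) : transportCost k μ ν ≤ 1 := by
  obtain ⟨γ, hγ⟩ := couplings_nonempty μ ν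
  calc transportCost k μ ν ≤ ∫ p, k p.1 p.2 ∂(γ : Measure (X × X)) :=
        transportCost_le_integral h0 hγ
    _ ≤ ∫ _, (1 : ℝ) ∂(γ : Measure (X × X)) :=
        integral_mono_of_nonneg (ae_of_all _ fun p => h0 p.1 p.2) (integrable_const 1)
          (ae_of_all _ fun p => h1 p.1 p.2)
    _ = 1 := by simp

theorem transportCost_self (hk : ∀ x y, 0 ≤ k x y)
    (hmeas : Measurable fun p : X × X => k p.1 p.2) (hself : ∀ x, k x x = 0) :
    transportCost k μ μ = 0 := by
  refine (transportCost_nonneg hk μ μ).antisymm' ?_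
  refine (transportCost_le_integral hk (map_diag_mem_couplings μ)).trans_eq ?_
  rw [ProbabilityMeasure.toMeasure_map,
    integral_map (by fun_prop) hmeas.aestronglyMeasurable]
  simp only [id_eq, hself, integral_zero]

theorem transportCost_symm_le (hk : ∀ x y, 0 ≤ k x y)
    (hmeas : Measurable fun p : X × X => k p.1 p.2) (hsymm : ∀ x y, k x y = k y x) :
    transportCost k μ ν ≤ transportCost k ν μ := by
  refine le_transportCost fun γ hγ => ?_
  calc transportCost k μ ν
      ≤ ∫ p, k p.1 p.2 ∂((γ : Measure (X × X)).map Prod.swap) :=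
        transportCost_le_integral hk (map_swap_mem_couplings hγ)
    _ = ∫ p, k p.2 p.1 ∂(γ : Measure (X × X)) :=
        integral_map measurable_swap.aemeasurable hmeas.aestronglyMeasurable
    _ = ∫ p, k p.1 p.2 ∂(γ : Measure (X × X)) := by simp only [hsymm]

theorem transportCost_le_integral_add_integral [StandardBorelSpace X]
    (hk : IsBoundedPseudometric k) (hmeas : Measurable fun p : X × X => k p.1 p.2)
    {γ₁ γ₂ : ProbabilityMeasure (X × X)} (h₁ : γ₁ ∈ couplings μ ν) (h₂ : γ₂ ∈ couplings ν ρ) :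
    transportCost k μ ρ ≤
      ∫ p, k p.1 p.2 ∂(γ₁ : Measure (X × X)) + ∫ p, k p.1 p.2 ∂(γ₂ : Measure (X × X)) := by
  obtain ⟨τ, hτ₁, hτ₂⟩ := exists_gluing h₁ h₂
  have hint : ∀ {f g : (X × X) × X → X}, Measurable f → Measurable g →
      Integrable (fun p => k (f p) (g p)) (τ : Measure ((X × X) × X)) := fun hf hg =>
    Integrable.of_mem_Icc 0 1 (hmeas.comp (hf.prodMk hg)).aemeasurable
      (ae_of_all _ fun _ => ⟨hk.nonneg _ _, hk.le_one _ _⟩)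
  calc transportCost k μ ρ
      ≤ ∫ p, k p.1 p.2 ∂((τ : Measure ((X × X) × X)).map (Prod.map Prod.fst id)) :=
        transportCost_le_integral hk.nonneg (map_fst_mem_couplings_of_gluing h₁ h₂ hτ₁ hτ₂)
    _ = ∫ p, k p.1.1 p.2 ∂(τ : Measure ((X × X) × X)) :=
        integral_map (by fun_prop) hmeas.aestronglyMeasurable
    _ ≤ ∫ p, (k p.1.1 p.1.2 + k p.1.2 p.2) ∂(τ : Measure ((X × X) × X)) :=
        integral_mono (hint (by fun_prop) (by fun_prop))
          ((hint (by fun_prop) (by fun_prop)).add (hint (by fun_prop) (by fun_prop)))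
          fun p => hk.triangle _ _ _
    _ = ∫ p, k p.1.1 p.1.2 ∂(τ : Measure ((X × X) × X)) +
          ∫ p, k p.1.2 p.2 ∂(τ : Measure ((X × X) × X)) :=
        integral_add (hint (by fun_prop) (by fun_prop)) (hint (by fun_prop) (by fun_prop))
    _ = ∫ p, k p.1 p.2 ∂(γ₁ : Measure (X × X)) + ∫ p, k p.1 p.2 ∂(γ₂ : Measure (X × X)) := by
        rw [← hτ₁, ← hτ₂, integral_map (by fun_prop) hmeas.aestronglyMeasurable,
          integral_map (by fun_prop) hmeas.aestronglyMeasurable]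
        rfl

theorem transportCost_triangle [StandardBorelSpace X] (hk : IsBoundedPseudometric k)
    (hmeas : Measurable fun p : X × X => k p.1 p.2) :
    transportCost k μ ρ ≤ transportCost k μ ν + transportCost k ν ρ := by
  rw [← sub_le_iff_le_add]
  refine le_transportCost fun γ₁ h₁ => ?_
  rw [sub_le_comm]
  refine le_transportCost fun γ₂ h₂ => ?_
  rw [sub_le_iff_le_add']
  exact transportCost_le_integral_add_integral hk hmeas h₁ h₂

theorem isBoundedPseudometric_transportCost [StandardBorelSpace X]
    (hk : IsBoundedPseudometric k) (hmeas : Measurable fun p : X × X => k p.1 p.2) :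
    IsBoundedPseudometric (transportCost k) where
  nonneg := transportCost_nonneg hk.nonneg
  le_one := transportCost_le_one hk.nonneg hk.le_one
  self _ := transportCost_self hk.nonneg hmeas hk.self
  symm _ _ := (transportCost_symm_le hk.nonneg hmeas hk.symm).antisymm
    (transportCost_symm_le hk.nonneg hmeas hk.symm)
  triangle _ _ _ := transportCost_triangle hk hmeas

end TransportCost

section LowerSemicontinuousCosts

/-- A lower semicontinuous cost function with values in `[0, 1]`: the class of costs for which
optimal couplings exist and the transport cost is continuous along increasing sequences. -/
structure IsLscCost {X : Type*} [TopologicalSpace X] (k : X → X → ℝ) : Prop where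
  lsc : LowerSemicontinuous fun p : X × X => k p.1 p.2
  nonneg : ∀ x y, 0 ≤ k x y
  le_one : ∀ x y, k x y ≤ 1

theorem IsLscPseudometric.isLscCost {X : Type*} [TopologicalSpace X] {m : X → X → ℝ}
    (hm : IsLscPseudometric m) : IsLscCost m :=
  ⟨hm.lsc, hm.nonneg, hm.le_one⟩

theorem bddAbove_range_of_le_one {X ι : Type*} {ks : ι → X → X → ℝ}
    (hks : ∀ i x y, ks i x y ≤ 1) (x y : X) : BddAbove (Set.range fun i => ks i x y) :=
  ⟨1, Set.forall_mem_range.2 fun i => hks i x y⟩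

theorem IsLscCost.iSup {X ι : Type*} [TopologicalSpace X] [Nonempty ι] {ks : ι → X → X → ℝ}
    (hks : ∀ i, IsLscCost (ks i)) : IsLscCost fun x y => ⨆ i, ks i x y where
  lsc := lowerSemicontinuous_ciSup
    (fun p => bddAbove_range_of_le_one (fun i => (hks i).le_one) p.1 p.2) fun i => (hks i).lsc
  nonneg x y := Real.iSup_nonneg fun i => (hks i).nonneg x y
  le_one x y := ciSup_le fun i => (hks i).le_one x y

variable {X : Type*} [TopologicalSpace X] [PolishSpace X] [MeasurableSpace X] [BorelSpace X]
  {k k' : X → X → ℝ} {μ ν : ProbabilityMeasure X}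

theorem IsLscCost.integrable (hk : IsLscCost k) (γ : Measure (X × X)) [IsFiniteMeasure γ] :
    Integrable (fun p => k p.1 p.2) γ :=
  integrable_of_lowerSemicontinuous hk.lsc (fun _ => ⟨hk.nonneg _ _, hk.le_one _ _⟩) γ

theorem IsLscCost.lowerSemicontinuous_integral (hk : IsLscCost k) :
    LowerSemicontinuous fun γ : ProbabilityMeasure (X × X) =>
      ∫ p, k p.1 p.2 ∂(γ : Measure (X × X)) :=
  TrajectoryMetric.lowerSemicontinuous_integral hk.lsc fun _ => ⟨hk.nonneg _ _, hk.le_one _ _⟩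

theorem IsLscCost.isClosed_integral_le (hk : IsLscCost k) (r : ℝ) :
    IsClosed {γ : ProbabilityMeasure (X × X) | ∫ p, k p.1 p.2 ∂(γ : Measure (X × X)) ≤ r} :=
  hk.lowerSemicontinuous_integral.isClosed_preimage r

theorem IsLscCost.exists_integral_eq_transportCost (hk : IsLscCost k)
    (μ ν : ProbabilityMeasure X) :
    ∃ γ ∈ couplings μ ν, ∫ p, k p.1 p.2 ∂(γ : Measure (X × X)) = transportCost k μ ν := by
  obtain ⟨γ, hγ, hmin⟩ := (hk.lowerSemicontinuous_integral.lowerSemicontinuousOn _).exists_isMinOn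
    (couplings_nonempty μ ν) (isCompact_couplings μ ν)
  exact ⟨γ, hγ, (le_transportCost hmin).antisymm (transportCost_le_integral hk.nonneg hγ)⟩

theorem IsLscCost.transportCost_le_iff (hk : IsLscCost k) {r : ℝ} :
    transportCost k μ ν ≤ r ↔
      ∃ γ ∈ couplings μ ν, ∫ p, k p.1 p.2 ∂(γ : Measure (X × X)) ≤ r := by
  constructor
  · intro h
    obtain ⟨γ, hγ, hopt⟩ := hk.exists_integral_eq_transportCost μ ν
    exact ⟨γ, hγ, hopt.trans_le h⟩
  · rintro ⟨γ, hγ, h⟩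
    exact (transportCost_le_integral hk.nonneg hγ).trans h

theorem IsLscCost.transportCost_mono (hk' : IsLscCost k') (h0 : ∀ x y, 0 ≤ k x y) (hle : k ≤ k')
    (μ ν : ProbabilityMeasure X) : transportCost k μ ν ≤ transportCost k' μ ν :=
  le_transportCost fun γ hγ => (transportCost_le_integral h0 hγ).trans <|
    integral_mono_of_nonneg (ae_of_all _ fun p => h0 p.1 p.2) (hk'.integrable γ)
      (ae_of_all _ fun p => hle p.1 p.2)

theorem IsLscCost.lowerSemicontinuous_transportCost (hk : IsLscCost k) :
    LowerSemicontinuous fun p : ProbabilityMeasure X × ProbabilityMeasure X =>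
      transportCost k p.1 p.2 := by
  refine lowerSemicontinuous_iff_isClosed_preimage.2 fun r => ?_
  have sublevel_eq : (fun p : ProbabilityMeasure X × ProbabilityMeasure X =>
      transportCost k p.1 p.2) ⁻¹' Set.Iic r =
      marginals '' {γ | ∫ p, k p.1 p.2 ∂(γ : Measure (X × X)) ≤ r} := by
    ext ⟨μ, ν⟩
    simp only [Set.mem_preimage, Set.mem_Iic, hk.transportCost_le_iff,
      mem_couplings_iff_marginals_eq, Set.mem_image, Set.mem_ofPred_eq, and_comm]
  rw [sublevel_eq]
  exact isProperMap_marginals.isClosedMap _ (hk.isClosed_integral_le r)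

theorem isLscPseudometric_transportCost (hk : IsLscPseudometric k) :
    IsLscPseudometric (transportCost k) where
  toIsBoundedPseudometric :=
    isBoundedPseudometric_transportCost hk.toIsBoundedPseudometric hk.lsc.measurable
  lsc := hk.isLscCost.lowerSemicontinuous_transportCost

theorem integral_iSup_le_of_forall_integral_le {ks : ℕ → X → X → ℝ} (hks : ∀ n, IsLscCost (ks n))
    (hmono : Monotone ks) {γ : ProbabilityMeasure (X × X)} {r : ℝ}
    (hγ : ∀ n, ∫ p, ks n p.1 p.2 ∂(γ : Measure (X × X)) ≤ r) :
    ∫ p, ⨆ n, ks n p.1 p.2 ∂(γ : Measure (X × X)) ≤ r := by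
  have hmono' : ∀ x y, Monotone fun n => ks n x y := fun x y i j hij => hmono hij x y
  refine le_of_tendsto' (integral_tendsto_of_tendsto_of_monotone
    (fun n => (hks n).integrable (γ : Measure (X × X))) ((IsLscCost.iSup hks).integrable _)
    (ae_of_all _ fun p => hmono' p.1 p.2) (ae_of_all _ fun p => ?_)) hγ
  exact tendsto_atTop_ciSup (hmono' p.1 p.2)
    (bddAbove_range_of_le_one (fun n => (hks n).le_one) p.1 p.2)

theorem transportCost_iSup {ks : ℕ → X → X → ℝ} (hks : ∀ n, IsLscCost (ks n))
    (hmono : Monotone ks) (μ ν : ProbabilityMeasure X) :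
    transportCost (fun x y => ⨆ n, ks n x y) μ ν = ⨆ n, transportCost (ks n) μ ν := by
  have hbdd : BddAbove (Set.range fun n => transportCost (ks n) μ ν) :=
    bddAbove_range_of_le_one (fun n => transportCost_le_one (hks n).nonneg (hks n).le_one) μ ν
  refine le_antisymm ?_ (ciSup_le fun n => (IsLscCost.iSup hks).transportCost_mono (hks n).nonneg
    (fun x y => le_ciSup (bddAbove_range_of_le_one (fun n => (hks n).le_one) x y) n) μ ν)
  set r := ⨆ n, transportCost (ks n) μ ν
  let K : ℕ → Set (ProbabilityMeasure (X × X)) := fun n =>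
    couplings μ ν ∩ {γ | ∫ p, ks n p.1 p.2 ∂(γ : Measure (X × X)) ≤ r}
  have hK_anti : ∀ n, K (n + 1) ⊆ K n := fun n γ hγ =>
    ⟨hγ.1, (integral_mono ((hks n).integrable γ) ((hks (n + 1)).integrable γ)
      fun p => hmono n.le_succ p.1 p.2).trans hγ.2⟩
  have hK_nonempty : ∀ n, (K n).Nonempty := fun n =>
    (hks n).transportCost_le_iff.1 (le_ciSup hbdd n)
  have hK_compact : ∀ n, IsCompact (K n) := fun n =>
    (isCompact_couplings μ ν).inter_right ((hks n).isClosed_integral_le r)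
  obtain ⟨γ, hγ⟩ := IsCompact.nonempty_iInter_of_sequence_nonempty_isCompact_isClosed K hK_anti
    hK_nonempty (hK_compact 0) fun n => (hK_compact n).isClosed
  rw [Set.mem_iInter] at hγ
  exact (IsLscCost.iSup hks).transportCost_le_iff.2
    ⟨γ, (hγ 0).1, integral_iSup_le_of_forall_integral_le hks hmono fun n => (hγ n).2⟩

end LowerSemicontinuousCosts

section Pseudometrics

variable {X Y : Type*} [TopologicalSpace X] [TopologicalSpace Y] {m : X → X → ℝ}

theorem IsLscPseudometric.iSup {ι : Type*} [Nonempty ι] {ms : ι → X → X → ℝ}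
    (hms : ∀ i, IsLscPseudometric (ms i)) : IsLscPseudometric fun x y => ⨆ i, ms i x y where
  lsc := (IsLscCost.iSup fun i => (hms i).isLscCost).lsc
  nonneg := (IsLscCost.iSup fun i => (hms i).isLscCost).nonneg
  le_one := (IsLscCost.iSup fun i => (hms i).isLscCost).le_one
  self x := by simp only [(hms _).self, ciSup_const]
  symm x y := by simp only [(hms _).symm x y]
  triangle x y z := ciSup_le fun i => ((hms i).triangle x y z).trans <|
    add_le_add (le_ciSup (bddAbove_range_of_le_one (fun i => (hms i).le_one) x y) i)
      (le_ciSup (bddAbove_range_of_le_one (fun i => (hms i).le_one) y z) i)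

theorem IsLscPseudometric.comp (hm : IsLscPseudometric m) {f : Y → X} (hf : Continuous f) :
    IsLscPseudometric fun x y => m (f x) (f y) where
  lsc := hm.lsc.comp (hf.prodMap hf)
  nonneg _ _ := hm.nonneg _ _
  le_one _ _ := hm.le_one _ _
  self _ := hm.self _
  symm _ _ := hm.symm _ _
  triangle _ _ _ := hm.triangle _ _ _

theorem IsLscPseudometric.const_mul (hm : IsLscPseudometric m) {a : ℝ} (ha : a ∈ Set.Icc 0 1) :
    IsLscPseudometric fun x y => a * m x y where
  lsc := (continuous_const_mul a).comp_lowerSemicontinuous hm.lsc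
    (monotone_mul_left_of_nonneg ha.1)
  nonneg x y := mul_nonneg ha.1 (hm.nonneg x y)
  le_one x y := mul_le_one₀ ha.2 (hm.nonneg x y) (hm.le_one x y)
  self x := by rw [hm.self, mul_zero]
  symm x y := by rw [hm.symm]
  triangle x y z := mul_add a (m x y) (m y z) ▸ mul_le_mul_of_nonneg_left (hm.triangle x y z) ha.1

theorem isLscPseudometric_obsDist (obs : C(X, unitInterval)) :
    IsLscPseudometric (obsDist obs) where
  lsc := Continuous.lowerSemicontinuous <|
    show Continuous fun p : X × X => |(obs p.1 : ℝ) - obs p.2| by fun_prop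
  nonneg _ _ := abs_nonneg _
  le_one x y := abs_sub_le_of_nonneg_of_le (obs x).2.1 (obs x).2.2 (obs y).2.1 (obs y).2.2
  self x := by rw [obsDist, sub_self, abs_zero]
  symm _ _ := abs_sub_comm _ _
  triangle _ _ _ := abs_sub_le _ _ _

theorem isLeast_iSup_iterate {F : (X → X → ℝ) → X → X → ℝ}
    (hF_maps : Set.MapsTo F {m | IsLscPseudometric m} {m | IsLscPseudometric m})
    (hF_mono : MonotoneOn F {m | IsLscPseudometric m})
    (hF_iSup : ∀ ms : ℕ → X → X → ℝ, (∀ n, IsLscPseudometric (ms n)) → Monotone ms →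
      F (fun x y => ⨆ n, ms n x y) = fun x y => ⨆ n, F (ms n) x y)
    {d₀ : X → X → ℝ} (hd₀ : IsLscPseudometric d₀) (hd₀_le : d₀ ≤ F d₀) :
    IsLeast {m | IsLscPseudometric m ∧ F m = m ∧ d₀ ≤ m} fun x y => ⨆ n, F^[n] d₀ x y := by
  have hlsc : ∀ n, IsLscPseudometric (F^[n] d₀) := fun n => hF_maps.iterate n hd₀
  have hsucc : ∀ n, F^[n + 1] d₀ = F (F^[n] d₀) := fun n => Function.iterate_succ_apply' F n d₀
  have hle_succ : ∀ n, F^[n] d₀ ≤ F^[n + 1] d₀ := fun n => by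
    induction n with
    | zero => exact hd₀_le
    | succ n ih =>
      rw [hsucc n, hsucc (n + 1)]
      exact hF_mono (hlsc n) (hlsc (n + 1)) ih
  have hbdd : ∀ x y, BddAbove (Set.range fun n => F^[n] d₀ x y) :=
    bddAbove_range_of_le_one fun n => (hlsc n).le_one
  have hfix : F (fun x y => ⨆ n, F^[n] d₀ x y) = fun x y => ⨆ n, F^[n] d₀ x y := by
    rw [hF_iSup _ hlsc (monotone_nat_of_le_succ hle_succ)]
    simp only [← hsucc]
    exact funext₂ fun x y => le_antisymm (ciSup_le fun n => le_ciSup (hbdd x y) (n + 1)) <|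
      ciSup_mono (bddAbove_range_of_le_one (fun n => (hlsc (n + 1)).le_one) x y)
        fun n => hle_succ n x y
  refine ⟨⟨IsLscPseudometric.iSup hlsc, hfix, fun x y => le_ciSup (hbdd x y) 0⟩, ?_⟩
  rintro m ⟨hm, hFm, hle⟩
  have hiter_le : ∀ n, F^[n] d₀ ≤ m := fun n => by
    induction n with
    | zero => exact hle
    | succ n ih => exact hsucc n ▸ (hF_mono (hlsc n) hm ih).trans_eq hFm
  exact fun x y => ciSup_le fun n => hiter_le n x y

end Pseudometrics

section DiscountedUniform

variable {E : Type*} [TopologicalSpace E] {c : ℝ} {m m' : E → E → ℝ}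

theorem rpow_mem_Icc (hc : c ∈ Set.Icc 0 1) (t : ℝ≥0) : c ^ (t : ℝ) ∈ Set.Icc (0 : ℝ) 1 :=
  ⟨Real.rpow_nonneg hc.1 _, Real.rpow_le_one hc.1 hc.2 t.coe_nonneg⟩

theorem rpow_mul_le_one (hc : c ∈ Set.Icc 0 1) (t : ℝ≥0) {a : ℝ} (ha : a ≤ 1) :
    c ^ (t : ℝ) * a ≤ 1 :=
  (mul_le_of_le_one_right (rpow_mem_Icc hc t).1 ha).trans (rpow_mem_Icc hc t).2

theorem discountedUniform_le_one (hc : c ∈ Set.Icc 0 1) (hm : ∀ x y, m x y ≤ 1)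
    (ω ω' : Trajectory E) : discountedUniform c m ω ω' ≤ 1 :=
  ciSup_le fun t => rpow_mul_le_one hc t (hm (ω t) (ω' t))

theorem le_discountedUniform (hc : c ∈ Set.Icc 0 1) (hm : ∀ x y, m x y ≤ 1)
    (ω ω' : Trajectory E) (t : ℝ≥0) :
    c ^ (t : ℝ) * m (ω t) (ω' t) ≤ discountedUniform c m ω ω' :=
  le_ciSup (f := fun t : ℝ≥0 => c ^ (t : ℝ) * m (ω t) (ω' t))
    ⟨1, Set.forall_mem_range.2 fun t => rpow_mul_le_one hc t (hm (ω t) (ω' t))⟩ t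

theorem discountedUniform_mono (hc : c ∈ Set.Icc 0 1) (hm' : ∀ x y, m' x y ≤ 1) (hle : m ≤ m') :
    discountedUniform c m ≤ discountedUniform c m' := fun ω ω' => ciSup_le fun t =>
  (mul_le_mul_of_nonneg_left (hle _ _) (rpow_mem_Icc hc t).1).trans
    (le_discountedUniform hc hm' ω ω' t)

theorem discountedUniform_iSup {ι : Type*} [Nonempty ι] (hc : c ∈ Set.Icc 0 1)
    {ms : ι → E → E → ℝ} (hms : ∀ i x y, ms i x y ≤ 1) :
    discountedUniform c (fun x y => ⨆ i, ms i x y) =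
      fun ω ω' => ⨆ i, discountedUniform c (ms i) ω ω' := by
  ext ω ω'
  have hbdd := bddAbove_range_of_le_one fun i => discountedUniform_le_one hc (hms i)
  refine le_antisymm (ciSup_le fun t => ?_) (ciSup_le fun i => ?_)
  · rw [Real.mul_iSup_of_nonneg (rpow_mem_Icc hc t).1]
    exact ciSup_le fun i => (le_discountedUniform hc (hms i) ω ω' t).trans
      (le_ciSup (hbdd ω ω') i)
  · exact discountedUniform_mono hc (fun x y => ciSup_le fun i => hms i x y)
      (fun x y => le_ciSup (bddAbove_range_of_le_one hms x y) i) ω ω'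

theorem isLscPseudometric_discountedUniform (hc : c ∈ Set.Icc 0 1) (hm : IsLscPseudometric m) :
    IsLscPseudometric (discountedUniform c m) :=
  IsLscPseudometric.iSup fun t =>
    (hm.comp (continuous_eval_const t)).const_mul (rpow_mem_Icc hc t)

end DiscountedUniform

section PathTransport

variable {E : Type*} [TopologicalSpace E] [MeasurableSpace E]

/-- The functional `𝓖_c` of an arbitrary family `P` of laws on the trajectory space, which need
not come from a diffusion: the cost of transporting `P x` to `P y` for the discounted uniform
distance. -/
noncomputable def pathTransport (P : E → ProbabilityMeasure (Trajectory E)) (c : ℝ)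
    (m : E → E → ℝ) : E → E → ℝ :=
  fun x y => transportCost (discountedUniform c m) (P x) (P y)

variable [PolishSpace E] [BorelSpace E] {P : E → ProbabilityMeasure (Trajectory E)} {c : ℝ}
  {m m' : E → E → ℝ}

theorem isLscPseudometric_pathTransport (hP : Continuous P) (hc : c ∈ Set.Icc 0 1)
    (hm : IsLscPseudometric m) : IsLscPseudometric (pathTransport P c m) :=
  (isLscPseudometric_transportCost (isLscPseudometric_discountedUniform hc hm)).comp hP

theorem pathTransport_mono (hc : c ∈ Set.Icc 0 1) (hm : IsLscPseudometric m)
    (hm' : IsLscPseudometric m') (hle : m ≤ m') : pathTransport P c m ≤ pathTransport P c m' :=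
  fun x y => (isLscPseudometric_discountedUniform hc hm').isLscCost.transportCost_mono
    (isLscPseudometric_discountedUniform hc hm).nonneg
    (discountedUniform_mono hc hm'.le_one hle) (P x) (P y)

theorem pathTransport_iSup (hc : c ∈ Set.Icc 0 1) {ms : ℕ → E → E → ℝ}
    (hms : ∀ n, IsLscPseudometric (ms n)) (hmono : Monotone ms) :
    pathTransport P c (fun x y => ⨆ n, ms n x y) =
      fun x y => ⨆ n, pathTransport P c (ms n) x y := by
  ext x y
  rw [pathTransport, discountedUniform_iSup hc fun n => (hms n).le_one]
  exact transportCost_iSup (fun n => (isLscPseudometric_discountedUniform hc (hms n)).isLscCost)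
    (fun i j hij => discountedUniform_mono hc (hms j).le_one (hmono hij)) (P x) (P y)

theorem le_pathTransport (hP₀ : ∀ x, ∀ᵐ ω ∂(P x : Measure (Trajectory E)), ω 0 = x)
    (hc : c ∈ Set.Icc 0 1) (hm : IsLscPseudometric m) : m ≤ pathTransport P c m := by
  refine fun x y => le_transportCost fun γ hγ => ?_
  have hx : ∀ᵐ p ∂(γ : Measure (Trajectory E × Trajectory E)), p.1 0 = x :=
    ae_of_ae_map measurable_fst.aemeasurable (hγ.1 ▸ hP₀ x)
  have hy : ∀ᵐ p ∂(γ : Measure (Trajectory E × Trajectory E)), p.2 0 = y :=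
    ae_of_ae_map measurable_snd.aemeasurable (hγ.2 ▸ hP₀ y)
  calc m x y = ∫ _, m x y ∂(γ : Measure (Trajectory E × Trajectory E)) := by simp
    _ ≤ ∫ p, discountedUniform c m p.1 p.2 ∂(γ : Measure (Trajectory E × Trajectory E)) := by
      refine integral_mono_ae (integrable_const _)
        ((isLscPseudometric_discountedUniform hc hm).isLscCost.integrable _) ?_
      filter_upwards [hx, hy] with p hpx hpy
      simpa [hpx, hpy] using le_discountedUniform hc hm.le_one p.1 p.2 0

end PathTransport

section Diffusion

variable {E : Type*} [TopologicalSpace E] [MeasurableSpace E] (D : Diffusion E)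

theorem Diffusion.continuous_law [SequentialSpace E] [OpensMeasurableSpace (Trajectory E)] :
    Continuous D.law :=
  SeqContinuous.continuous fun u x hu =>
    ProbabilityMeasure.tendsto_iff_forall_integral_tendsto.2 (D.weakly_continuous u x hu)

theorem Diffusion.ae_eval_zero_eq [MeasurableSingletonClass E] (x : E) :
    ∀ᵐ ω ∂(D.law x : Measure (Trajectory E)), ω 0 = x := by
  have hprob : (D.law x : Measure (Trajectory E)) {ω | ω 0 = x} = 1 := by
    simpa [cylinderProb] using D.isLawFrom x {x} [] (measurableSet_singleton x) (by simp) (by simp)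
  exact (mem_ae_iff_prob_eq_one (measurable_eval 0 (measurableSet_singleton x))).2 hprob

theorem Diffusion.iterate_eq_iterate_pathTransport (obs : C(E, unitInterval)) (c : ℝ) (n : ℕ) :
    D.iterate obs c n = (pathTransport D.law c)^[n] (obsDist obs) := by
  induction n with
  | zero => rfl
  | succ n ih => rw [Function.iterate_succ_apply', ← ih]; rfl

end Diffusion

end TrajectoryMetric

open TrajectoryMetric in
theorem mainTheorem2_general {E : Type*} [TopologicalSpace E] [PolishSpace E] [MeasurableSpace E]
    [BorelSpace E] {P : E → ProbabilityMeasure (Trajectory E)} (hP : Continuous P)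
    (hP₀ : ∀ x, ∀ᵐ ω ∂(P x : Measure (Trajectory E)), ω 0 = x) {d₀ : E → E → ℝ}
    (hd₀ : IsLscPseudometric d₀) {c : ℝ} (hc : c ∈ Set.Icc 0 1) :
    IsLeast {m | IsLscPseudometric m ∧ pathTransport P c m = m ∧ d₀ ≤ m}
      fun x y => ⨆ n, (pathTransport P c)^[n] d₀ x y :=
  isLeast_iSup_iterate (fun _ => isLscPseudometric_pathTransport hP hc)
    (fun _ hm _ hm' => pathTransport_mono hc hm hm') (fun _ => pathTransport_iSup hc) hd₀
    (le_pathTransport hP₀ hc hd₀)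

theorem mainTheorem2 {E : Type*} [TopologicalSpace E] [LocallyCompactSpace E] [T2Space E]
    [SecondCountableTopology E] [MeasurableSpace E] [BorelSpace E]
    (D : TrajectoryMetric.Diffusion E) (obs : C(E, unitInterval)) (c : ℝ)
    (hc0 : 0 < c) (hc1 : c < 1) :
    IsLeast {m : E → E → ℝ | TrajectoryMetric.IsLscPseudometric m ∧ D.functional c m = m ∧
        TrajectoryMetric.obsDist obs ≤ m}
      (D.dbar obs c) := by
  have := TrajectoryMetric.polishSpace_of_locallyCompactSpace E
  unfold TrajectoryMetric.Diffusion.dbar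
  simp only [D.iterate_eq_iterate_pathTransport]
  exact mainTheorem2_general D.continuous_law D.ae_eval_zero_eq
    (TrajectoryMetric.isLscPseudometric_obsDist obs) ⟨hc0.le, hc1.le⟩
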